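/- **Proposition (Combination of errors).** Let $\Omega$ be a set and let $P:\Omega\to[0,1]$ attain the value $1$. Write $\Pi(C)=\sup_{\omega\in C}P(\omega)$ for $C\subseteq\Omega$ (with $\sup\emptyset=0$) for the possibility measure determined by $P$. A map $X:\Omega\to\mathbb{R}$ (a fuzzy variable) has distribution given by $A:\mathbb{R}\to[0,1]$ if $\Pi(X\in C)=\sup_{x\in C}A(x)$ for all $C\subseteq\mathbb{R}$. Let $T:[0,1]^2\to[0,1]$ be a continuous Archimedean $t$-norm, that is, a continuous, commutative, associative operation, non-decreasing in both variables, with neutral element $1$, such that for all $x,y\in(0,1)$ there is $n$ with $T(x,\dots,x)<y$ ($n$ arguments). Let $A:\mathbb{R}\to[0,1]$ be a fuzzy number: for every $\alpha\in(0,1]$ the set $A^\alpha=\{x: A(x)\ge\alpha\}$ is nonempty, compact and convex, and there is exactly one point $m\in\mathbb{R}$ (the modal value of $A$) with $A(m)=1$. Let $(X_n)_{n\ge1}$ be fuzzy variables on $(\Omega,\Pi)$, all with distribution given by $A$, which are $T$-independent: for every finite set $J$ of indices and all $C_j\subseteq\mathbb{R}$ $(j\in J)$, $\Pi\bigl(\bigcap_{j\in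 J}\{X_j\in C_j\}\bigr)$ equals the $T$-combination of the numbers $\Pi(X_j\in C_j)$, $j\in J$. Let $Y:\Omega\to\mathbb{R}$ be a fuzzy variable whose distribution is given by the characteristic function of some set $B\subseteq\mathbb{R}$; its dependence on the $X_n$ is arbitrary. Put $Z_n=X_n+Y$ and $$A_n=\mathrm{Ave}(Z_1,\dots,Z_n)=\frac1n\sum_{j=1}^nZ_j,\qquad M_n=\mathrm{Med}(Z_1,\dots,Z_n),$$ where $\mathrm{Med}$ is the sample median (the midpoint of the two middle order statistics when $n$ is even). Then $(A_n)$ and $(M_n)$ both converge to $Y+m$ in measure and almost surely: for every $\varepsilon>0$, $$\lim_{n\to\infty}\Pi\bigl(|A_n-(Y+m)|\ge\varepsilon\bigr)=0,\qquad \lim_{n\to\infty}\Pi\bigl(|M_n-(Y+m)|\ge\varepsilon\bigr)=0,$$ and $$\Pi\bigl(\{\omega: A_n(\omega)\not\to Y(\omega)+m\}\bigr)=0,\qquad \Pi\bigl(\{\omega: M_n(\omega)\not\to Y(\omega)+m\}\bigr)=0 .$$ -/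

import Mathlib

open Filter Topology

namespace Fuzzy

/-! ### Triangular norms -/

/-- A `t`-norm: a commutative, associative operation on `[0,1]`, non-decreasing in both variables,
with neutral element `1`.  (Monotonicity in the second variable follows by commutativity.) -/
structure TNorm where
  op : unitInterval → unitInterval → unitInterval
  comm : ∀ a b, op a b = op b a
  assoc : ∀ a b c, op (op a b) c = op a (op b c)
  mono_left : ∀ a b c, a ≤ b → op a c ≤ op b c
  op_one : ∀ a, op a 1 = a

instance (T : TNorm) : Std.Commutative T.op := ⟨T.comm⟩

instance (T : TNorm) : Std.Associative T.op := ⟨T.assoc⟩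

/-- The extension of a `t`-norm to finitely many arguments `a i`, `i ∈ s`
(the value for `s = ∅` is the neutral element `1`). -/
def TNorm.fold (T : TNorm) {ι : Type*} (s : Finset ι) (a : ι → unitInterval) : unitInterval :=
  s.fold T.op 1 a

/-- The `t`-norm is (jointly) continuous. -/
def TNorm.IsContinuous (T : TNorm) : Prop :=
  Continuous fun p : unitInterval × unitInterval => T.op p.1 p.2

/-- The `t`-norm is Archimedean: for all `x, y ∈ (0,1)` there is an `n` such that
`T(x, …, x) < y`, with `n` arguments. -/
def TNorm.IsArchimedean (T : TNorm) : Prop :=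
  ∀ x y : unitInterval, 0 < x → x < 1 → 0 < y → y < 1 →
    ∃ n : ℕ, T.fold (Finset.range n) (fun _ => x) < y

/-! ### Fuzzy sets -/

/-- A (normalized) fuzzy set: a membership function `A : Ω → [0,1]` attaining the value `1`. -/
def IsFuzzySet {Ω : Type*} (A : Ω → unitInterval) : Prop :=
  ∃ x, A x = 1

/-- The `α`-cut of a fuzzy set. -/
def cut {Ω : Type*} (A : Ω → unitInterval) (α : unitInterval) : Set Ω :=
  {x | α ≤ A x}

/-- Compact fuzzy sets: all `α`-cuts, `α ∈ (0,1]`, are compact and nonempty. -/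
def IsCompactFuzzySet {E : Type*} [TopologicalSpace E] (A : E → unitInterval) : Prop :=
  IsFuzzySet A ∧ ∀ α : unitInterval, 0 < α → IsCompact (cut A α) ∧ (cut A α).Nonempty

/-- Fuzzy intervals: compact fuzzy sets whose `α`-cuts, `α ∈ (0,1]`, are convex. -/
def IsFuzzyInterval {E : Type*} [TopologicalSpace E] [AddCommGroup E] [Module ℝ E]
    (A : E → unitInterval) : Prop :=
  IsCompactFuzzySet A ∧ ∀ α : unitInterval, 0 < α → Convex ℝ (cut A α)

/-- Fuzzy numbers: fuzzy intervals taking the value `1` at exactly one point. -/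
def IsFuzzyNumber {E : Type*} [TopologicalSpace E] [AddCommGroup E] [Module ℝ E]
    (A : E → unitInterval) : Prop :=
  IsFuzzyInterval A ∧ ∃! x, A x = 1

/-- The modal value of a fuzzy number, i.e. the unique point at which `A` takes the value `1`. -/
noncomputable def modalValue {E : Type*} [TopologicalSpace E] [AddCommGroup E] [Module ℝ E]
    (A : E → unitInterval) (hA : IsFuzzyNumber A) : E :=
  hA.2.choose

theorem cut_one_eq_modalValue {E : Type*} [TopologicalSpace E] [AddCommGroup E] [Module ℝ E]
    (A : E → unitInterval) (hA : IsFuzzyNumber A) : cut A 1 = {modalValue A hA} := by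
  ext x
  have h1 : A (modalValue A hA) = 1 := hA.2.choose_spec.1
  constructor
  · intro hx
    exact hA.2.choose_spec.2 x (le_antisymm (A x).2.2 hx)
  · intro hx
    rw [Set.mem_singleton_iff] at hx
    simp [cut, hx, h1]

/-- The fuzzy set given by the characteristic function of a (crisp) set `B`. -/
noncomputable def crisp {E : Type*} (B : Set E) : E → unitInterval :=
  B.indicator fun _ => 1

/-! ### Possibility measures and fuzzy variables -/

/-- The possibility measure determined by `P : Ω → [0,1]`: the supremum of `P` over `B`
(taken in `[0,1]`, so it is `0` for `B = ∅`). -/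
noncomputable def poss {Ω : Type*} (P : Ω → unitInterval) (B : Set Ω) : unitInterval :=
  sSup (P '' B)

/-- The fuzzy variable `X` on `Ω`, equipped with the possibility measure of `P`, has distribution
given by the fuzzy set `A`: the induced measure `C ↦ Π(X ∈ C)` is the possibility measure
determined by `A`. -/
def HasDistribution {Ω E : Type*} (P : Ω → unitInterval) (X : Ω → E) (A : E → unitInterval) :
    Prop :=
  ∀ C : Set E, poss P (X ⁻¹' C) = poss A C

/-- `T`-independence of a family of fuzzy variables: for every finite subfamily,
`Π(X i ∈ C i for all i) = T(Π(X i ∈ C i))`. -/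
def TIndependent {Ω E ι : Type*} (P : Ω → unitInterval) (T : TNorm) (X : ι → Ω → E) : Prop :=
  ∀ (s : Finset ι) (C : ι → Set E),
    poss P (⋂ i ∈ s, X i ⁻¹' C i) = T.fold s fun i => poss P (X i ⁻¹' C i)

/-- Convergence in measure: `Π(|X n - X| ≥ ε) → 0` for every `ε > 0`. -/
def ConvergesInMeasure {Ω E : Type*} [MetricSpace E] (P : Ω → unitInterval)
    (X : ℕ → Ω → E) (L : Ω → E) : Prop :=
  ∀ ε : ℝ, 0 < ε → Tendsto (fun n => poss P {ω | ε ≤ dist (X n ω) (L ω)}) atTop (𝓝 0)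

/-- Almost sure convergence: `Π({ω : not X n ω → L ω}) = 0`. -/
def ConvergesAlmostSurely {Ω E : Type*} [MetricSpace E] (P : Ω → unitInterval)
    (X : ℕ → Ω → E) (L : Ω → E) : Prop :=
  poss P {ω | ¬ Tendsto (fun n => X n ω) atTop (𝓝 (L ω))} = 0

/-! ### Mean and median of finite samples (of size `n + 1`) -/

/-- The arithmetic mean of `n + 1` real numbers. -/
noncomputable def ave {n : ℕ} (x : Fin (n + 1) → ℝ) : ℝ :=
  (∑ i, x i) / (n + 1 : ℝ)

/-- The `k`-th order statistic (counted from `0`): the `k`-th entry of the sample `x` arranged in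
non-decreasing order. -/
noncomputable def orderStat {n : ℕ} (x : Fin (n + 1) → ℝ) (k : Fin (n + 1)) : ℝ :=
  x (Tuple.sort x k)

/-- The median of `n + 1` real numbers: the middle order statistic if the sample size `n + 1` is
odd (the two indices below coincide then), the midpoint of the two middle order statistics if it
is even. -/
noncomputable def med {n : ℕ} (x : Fin (n + 1) → ℝ) : ℝ :=
  (orderStat x ⟨n / 2, by omega⟩ + orderStat x ⟨(n + 1) / 2, by omega⟩) / 2

end Fuzzy

/-! Outliers are uniformly few. Off the interval of radius `δ` about `m`, the membership function
stays below some `q < 1`, so by independence a point `ω` with `N` deviations `|X j ω - m| ≥ δ` has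
`P ω` at most the `N`-th `T`-power of `q`. The Archimedean property makes this power less than `α`,
so `{P ≥ α}` admits only boundedly many outliers, whatever `ω` and `n`
(`TIndependent.exists_card_deviation_lt`). As `Z j - (Y + m) = X j - m`, the variable `Y` plays no
role. Bounded outliers (compact `α`-cut) shift the mean by `O(1/n)`, and a minority of outliers
cannot dominate the median. Convergence is thus uniform on each `{P ≥ α}`, which yields both modes.
-/

namespace Fuzzy

/-! ### Folds of a `t`-norm -/

namespace TNorm

variable (T : TNorm)

theorem mono {a b c d : unitInterval} (hab : a ≤ b) (hcd : c ≤ d) : T.op a c ≤ T.op b d := by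
  refine (T.mono_left a b c hab).trans ?_
  rw [T.comm b c, T.comm b d]
  exact T.mono_left c d b hcd

theorem fold_mono {ι : Type*} (s : Finset ι) {a b : ι → unitInterval}
    (h : ∀ i ∈ s, a i ≤ b i) : T.fold s a ≤ T.fold s b := by
  classical
  induction s using Finset.induction_on with
  | empty => exact le_rfl
  | insert i s hi ih =>
    simp only [fold, Finset.fold_insert hi] at ih ⊢
    exact T.mono (h i (Finset.mem_insert_self i s))
      (ih fun j hj => h j (Finset.mem_insert_of_mem hj))

theorem fold_const {ι : Type*} (s : Finset ι) (x : unitInterval) :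
    T.fold s (fun _ => x) = (T.op x)^[s.card] 1 := by
  classical
  induction s using Finset.induction_on with
  | empty => rfl
  | insert i s hi ih =>
    simp only [fold, Finset.fold_insert hi, Finset.card_insert_of_notMem hi,
      Function.iterate_succ_apply'] at ih ⊢
    rw [ih]

theorem fold_const_eq_of_card_eq {ι κ : Type*} {s : Finset ι} {t : Finset κ}
    (h : s.card = t.card) (x : unitInterval) :
    T.fold s (fun _ => x) = T.fold t (fun _ => x) := by
  rw [fold_const, fold_const, h]

/-- For an Archimedean `t`-norm the powers of any `x < 1` fall below any `y > 0`. -/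
theorem IsArchimedean.exists_fold_range_lt {T : TNorm} (hT : T.IsArchimedean)
    {x y : unitInterval} (hx : x < 1) (hy : 0 < y) :
    ∃ n : ℕ, T.fold (Finset.range n) (fun _ => x) < y := by
  obtain ⟨r, hr0, hr1⟩ := exists_between (zero_lt_one (α := unitInterval))
  -- `r` moves the endpoint cases `x = 0` and `y = 1` into the open interval.
  obtain ⟨n, hn⟩ := hT (max x r) (min y r) (lt_max_of_lt_right hr0) (max_lt hx hr1)
    (lt_min hy hr0) (min_lt_of_right_lt hr1)
  exact ⟨n, (T.fold_mono _ fun _ _ => le_max_left x r).trans_lt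
    (hn.trans_le (min_le_left y r))⟩

end TNorm

/-! ### Possibility measures -/

section Poss

variable {Ω E : Type*} {P : Ω → unitInterval}

theorem le_poss {C : Set Ω} {ω : Ω} (h : ω ∈ C) : P ω ≤ poss P C :=
  le_sSup (Set.mem_image_of_mem P h)

theorem poss_le {C : Set Ω} {a : unitInterval} (h : ∀ ω ∈ C, P ω ≤ a) : poss P C ≤ a :=
  sSup_le (Set.forall_mem_image.2 h)

theorem HasDistribution.le_apply {X : Ω → E} {A : E → unitInterval}
    (hX : HasDistribution P X A) (ω : Ω) : P ω ≤ A (X ω) := by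
  have h : P ω ≤ poss P (X ⁻¹' {X ω}) := le_poss rfl
  rw [hX] at h
  exact h.trans (poss_le fun x hx => by rw [Set.mem_singleton_iff.1 hx])

variable [MetricSpace E] {X : ℕ → Ω → E} {L : Ω → E}

/-- For large `n` the deviation event misses `{P ≥ α}`, so its possibility is at most `α`. -/
theorem convergesInMeasure_of_uniform
    (h : ∀ α : unitInterval, 0 < α → ∀ ε : ℝ, 0 < ε →
      ∀ᶠ n in atTop, ∀ ω, α ≤ P ω → dist (X n ω) (L ω) < ε) :
    ConvergesInMeasure P X L := by
  intro ε hε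
  rw [tendsto_order]
  refine ⟨fun a ha => absurd ha (not_lt.2 a.2.1), fun a ha => ?_⟩
  obtain ⟨α, hα0, hαa⟩ := exists_between ha
  filter_upwards [h α hα0 ε hε] with n hn
  refine (poss_le fun ω hω => ?_).trans_lt hαa
  by_contra hlt
  exact absurd (hn ω (not_le.1 hlt).le) (not_lt.2 hω)

/-- Taking `α = P ω` gives convergence at every `ω` with `P ω > 0`. -/
theorem convergesAlmostSurely_of_uniform
    (h : ∀ α : unitInterval, 0 < α → ∀ ε : ℝ, 0 < ε →
      ∀ᶠ n in atTop, ∀ ω, α ≤ P ω → dist (X n ω) (L ω) < ε) :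
    ConvergesAlmostSurely P X L := by
  refine le_antisymm (poss_le fun ω hω => ?_) (poss P _).2.1
  by_contra hpos
  refine hω (Metric.tendsto_nhds.2 fun ε hε => ?_)
  filter_upwards [h (P ω) (not_le.1 hpos) ε hε] with n hn
  exact hn ω le_rfl

end Poss

/-! ### Fuzzy numbers on the line -/


theorem IsFuzzyNumber.apply_modalValue {A : ℝ → unitInterval} (hA : IsFuzzyNumber A) :
    A (modalValue A hA) = 1 :=
  hA.2.choose_spec.1

theorem IsFuzzyNumber.lt_one {A : ℝ → unitInterval} (hA : IsFuzzyNumber A) {x : ℝ}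
    (hx : x ≠ modalValue A hA) : A x < 1 :=
  lt_of_le_of_ne (A x).2.2 fun h => hx (hA.2.choose_spec.2 x h)

/-- Membership decreases along rays starting at the modal value. -/
theorem IsFuzzyNumber.le_of_mem_segment {A : ℝ → unitInterval} (hA : IsFuzzyNumber A) {x y : ℝ}
    (hy : y ∈ segment ℝ (modalValue A hA) x) : A x ≤ A y := by
  rcases (A x).2.1.eq_or_lt with h0 | h0
  · exact (Subtype.ext h0.symm : A x = 0).le.trans (A y).2.1
  · refine (hA.1.2 (A x) h0).segment_subset ?_ (le_refl (A x) : x ∈ cut A (A x)) hy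
    change A x ≤ A (modalValue A hA)
    rw [hA.apply_modalValue]
    exact (A x).2.2

/-- Away from the modal value the membership function is bounded away from `1`. -/
theorem IsFuzzyNumber.exists_lt_one_forall_le {A : ℝ → unitInterval} (hA : IsFuzzyNumber A)
    {δ : ℝ} (hδ : 0 < δ) :
    ∃ q : unitInterval, q < 1 ∧ ∀ x, δ ≤ |x - modalValue A hA| → A x ≤ q := by
  set m := modalValue A hA with hm
  -- By convexity of the cuts, the worst points are the nearest ones, `m ± δ`.
  refine ⟨max (A (m - δ)) (A (m + δ)), max_lt (hA.lt_one ?_) (hA.lt_one ?_), fun x hx => ?_⟩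
  · rw [← hm]; linarith
  · rw [← hm]; linarith
  rcases le_abs.1 hx with h | h
  · refine le_max_of_le_right (hA.le_of_mem_segment ?_)
    rw [← hm, segment_eq_Icc (by linarith)]
    constructor <;> linarith
  · refine le_max_of_le_left (hA.le_of_mem_segment ?_)
    rw [← hm, segment_symm, segment_eq_Icc (by linarith)]
    constructor <;> linarith

theorem IsFuzzyNumber.exists_abs_sub_le {A : ℝ → unitInterval} (hA : IsFuzzyNumber A)
    {α : unitInterval} (hα : 0 < α) :
    ∃ R : ℝ, 0 ≤ R ∧ ∀ x, α ≤ A x → |x - modalValue A hA| ≤ R := by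
  obtain ⟨R, hR⟩ := (hA.1.1.2 α hα).1.isBounded.subset_closedBall (modalValue A hA)
  refine ⟨max R 0, le_max_right _ _, fun x hx => le_max_of_le_left ?_⟩
  simpa [Real.dist_eq] using hR hx

/-! ### Few large deviations in independent samples -/

/-- On `{P ≥ α}` only a uniformly bounded number of the variables of a `T`-independent sequence
can deviate from the modal value by `δ` or more. -/
theorem TIndependent.exists_card_deviation_lt {Ω : Type*} {P : Ω → unitInterval} {T : TNorm}
    (hT : T.IsArchimedean) {A : ℝ → unitInterval} (hA : IsFuzzyNumber A) {X : ℕ → Ω → ℝ}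
    (hind : TIndependent P T X) (hdist : ∀ n, HasDistribution P (X n) A)
    {α : unitInterval} (hα : 0 < α) {δ : ℝ} (hδ : 0 < δ) :
    ∃ N : ℕ, ∀ ω, α ≤ P ω → ∀ s : Finset ℕ,
      (∀ j ∈ s, δ ≤ |X j ω - modalValue A hA|) → s.card < N := by
  obtain ⟨q, hq1, hq⟩ := hA.exists_lt_one_forall_le hδ
  obtain ⟨N, hN⟩ := hT.exists_fold_range_lt hq1 hα
  refine ⟨N, fun ω hω s hs => ?_⟩
  by_contra hcard
  -- Exactly `N` outliers are kept, to match the exponent in `hN`.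
  obtain ⟨t, hts, ht⟩ := Finset.exists_subset_card_eq (not_lt.1 hcard)
  have h1 : P ω ≤ poss P (⋂ i ∈ t, X i ⁻¹' {x | δ ≤ |x - modalValue A hA|}) :=
    le_poss (Set.mem_iInter₂.2 fun i hi => hs i (hts hi))
  rw [hind t fun _ => {x | δ ≤ |x - modalValue A hA|}] at h1
  have h2 := h1.trans (T.fold_mono t (b := fun _ => q) fun i _ => by
    rw [hdist i]
    exact poss_le hq)
  rw [T.fold_const_eq_of_card_eq (ht.trans (Finset.card_range N).symm)] at h2
  exact absurd (hω.trans h2) (not_le.2 hN)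

/-! ### Mean and median of samples with few outliers -/

section Sample

variable {n N : ℕ} {x : Fin (n + 1) → ℝ} {c δ : ℝ}

theorem abs_ave_sub_le {R : ℝ} (hδ : 0 ≤ δ) (hR : 0 ≤ R) (hx : ∀ i, |x i - c| ≤ R)
    (hN : (Finset.univ.filter fun i => δ ≤ |x i - c|).card ≤ N) :
    |ave x - c| ≤ δ + N * R / (n + 1) := by
  have hn : (0 : ℝ) < n + 1 := by positivity
  have hrepr : ave x - c = (∑ i, (x i - c)) / (n + 1) := by
    rw [ave, Finset.sum_sub_distrib]
    simp
    field_simp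
  have hsum : |∑ i, (x i - c)| ≤ (n + 1) * δ + N * R := by
    calc |∑ i, (x i - c)| ≤ ∑ i, |x i - c| := Finset.abs_sum_le_sum_abs _ _
      _ ≤ ∑ i, (δ + if δ ≤ |x i - c| then R else 0) := by
        refine Finset.sum_le_sum fun i _ => ?_
        split_ifs with h
        · linarith [hx i]
        · linarith
      _ = (n + 1) * δ + (Finset.univ.filter fun i => δ ≤ |x i - c|).card * R := by
        rw [Finset.sum_add_distrib, ← Finset.sum_filter]
        simp
      _ ≤ (n + 1) * δ + N * R := by gcongr
  rw [hrepr, abs_div, abs_of_pos hn, div_le_iff₀ hn, add_mul, div_mul_cancel₀ _ hn.ne']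
  linarith

theorem orderStat_mono {k l : Fin (n + 1)} (h : k ≤ l) : orderStat x k ≤ orderStat x l :=
  Tuple.monotone_sort x h

/-- A high outlier at rank `k` forces the `n + 1 - k` ranks from `k` up to be outliers; a low one
forces the `k + 1` ranks up to `k`. Both counts exceed `N`. -/
theorem abs_orderStat_sub_lt {k : Fin (n + 1)}
    (hN : (Finset.univ.filter fun i => δ ≤ |x i - c|).card ≤ N)
    (hk : N ≤ k) (hk' : k + N ≤ n) : |orderStat x k - c| < δ := by
  by_contra hcon
  have key : ∀ s : Finset (Fin (n + 1)), (∀ i ∈ s, δ ≤ |orderStat x i - c|) → s.card ≤ N := by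
    intro s hs
    rw [← Finset.card_map (Tuple.sort x).toEmbedding]
    refine (Finset.card_le_card fun i hi => ?_).trans hN
    obtain ⟨j, hj, rfl⟩ := Finset.mem_map.1 hi
    exact Finset.mem_filter.2 ⟨Finset.mem_univ _, hs j hj⟩
  rcases le_abs.1 (not_lt.1 hcon) with h | h
  · have := key (Finset.Ici k) fun i hi => le_abs.2 (Or.inl
      (h.trans (sub_le_sub_right (orderStat_mono (Finset.mem_Ici.1 hi)) c)))
    rw [Fin.card_Ici] at this
    omega
  · have := key (Finset.Iic k) fun i hi => le_abs.2 (Or.inr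
      (h.trans (neg_le_neg (sub_le_sub_right (orderStat_mono (Finset.mem_Iic.1 hi)) c))))
    rw [Fin.card_Iic] at this
    omega

theorem abs_med_sub_lt (hN : (Finset.univ.filter fun i => δ ≤ |x i - c|).card ≤ N)
    (hn : 2 * N + 1 ≤ n) : |med x - c| < δ := by
  have h1 := abs_lt.1 (abs_orderStat_sub_lt (k := ⟨n / 2, by omega⟩) hN
    (by simp only; omega) (by simp only; omega))
  have h2 := abs_lt.1 (abs_orderStat_sub_lt (k := ⟨(n + 1) / 2, by omega⟩) hN
    (by simp only; omega) (by simp only; omega))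
  rw [med, abs_lt]
  constructor <;> linarith [h1.1, h1.2, h2.1, h2.2]

end Sample

theorem card_filter_fin_le {p : ℕ → Prop} [DecidablePred p] {N : ℕ}
    (h : ∀ s : Finset ℕ, (∀ j ∈ s, p j) → s.card < N) (n : ℕ) :
    (Finset.univ.filter fun i : Fin n => p i).card ≤ N := by
  rw [← Finset.card_map Fin.valEmbedding]
  refine (h _ fun j hj => ?_).le
  obtain ⟨i, hi, rfl⟩ := Finset.mem_map.1 hj
  exact (Finset.mem_filter.1 hi).2

end Fuzzy

theorem mainTheorem10 {Ω : Type*} (P : Ω → unitInterval) (hP : Fuzzy.IsFuzzySet P)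
    (T : Fuzzy.TNorm) (hTc : T.IsContinuous) (hTa : T.IsArchimedean)
    (A : ℝ → unitInterval) (hA : Fuzzy.IsFuzzyNumber A)
    (X : ℕ → Ω → ℝ) (hXind : Fuzzy.TIndependent P T X)
    (hXdist : ∀ n, Fuzzy.HasDistribution P (X n) A)
    (B : Set ℝ) (Y : Ω → ℝ) (hY : Fuzzy.HasDistribution P Y (Fuzzy.crisp B))
    (Z : ℕ → Ω → ℝ) (hZ : ∀ n ω, Z n ω = X n ω + Y ω) :
    Fuzzy.ConvergesInMeasure P (fun n ω => Fuzzy.ave fun i : Fin (n + 1) => Z i ω)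
        (fun ω => Y ω + Fuzzy.modalValue A hA) ∧
      Fuzzy.ConvergesAlmostSurely P (fun n ω => Fuzzy.ave fun i : Fin (n + 1) => Z i ω)
        (fun ω => Y ω + Fuzzy.modalValue A hA) ∧
      Fuzzy.ConvergesInMeasure P (fun n ω => Fuzzy.med fun i : Fin (n + 1) => Z i ω)
        (fun ω => Y ω + Fuzzy.modalValue A hA) ∧
      Fuzzy.ConvergesAlmostSurely P (fun n ω => Fuzzy.med fun i : Fin (n + 1) => Z i ω)
        (fun ω => Y ω + Fuzzy.modalValue A hA) := by
  set m := Fuzzy.modalValue A hA with hm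
  have hsub : ∀ j ω, Z j ω - (Y ω + m) = X j ω - m := fun j ω => by rw [hZ]; ring
  have hdev : ∀ α : unitInterval, 0 < α → ∀ δ : ℝ, 0 < δ → ∃ N : ℕ, ∀ ω, α ≤ P ω → ∀ n : ℕ,
      (Finset.univ.filter fun i : Fin (n + 1) => δ ≤ |Z i ω - (Y ω + m)|).card ≤ N := by
    intro α hα δ hδ
    obtain ⟨N, hN⟩ := hXind.exists_card_deviation_lt hTa hA hXdist hα hδ
    refine ⟨N, fun ω hω n => Fuzzy.card_filter_fin_le (p := fun j => δ ≤ |Z j ω - (Y ω + m)|)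
      (fun s hs => hN ω hω s fun j hj => ?_) (n + 1)⟩
    rw [← hm, ← hsub]
    exact hs j hj
  have ave_close : ∀ α : unitInterval, 0 < α → ∀ ε : ℝ, 0 < ε → ∀ᶠ n : ℕ in atTop, ∀ ω, α ≤ P ω →
      dist (Fuzzy.ave fun i : Fin (n + 1) => Z i ω) (Y ω + m) < ε := by
    intro α hα ε hε
    -- Half of `ε` covers the small deviations, the other half the outlier term `N * R / (n + 1)`.
    obtain ⟨N, hN⟩ := hdev α hα (ε / 2) (half_pos hε)
    obtain ⟨R, hR0, hR⟩ := hA.exists_abs_sub_le hα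
    have hlim : Tendsto (fun n : ℕ => (N * R : ℝ) / ((n : ℝ) + 1)) atTop (𝓝 0) :=
      tendsto_const_nhds.div_atTop
        (tendsto_atTop_add_const_right _ 1 tendsto_natCast_atTop_atTop)
    filter_upwards [hlim.eventually_lt_const (half_pos hε)] with n hn ω hω
    rw [Real.dist_eq]
    have := Fuzzy.abs_ave_sub_le (half_pos hε).le hR0 (fun i : Fin (n + 1) => by
      rw [hsub]
      exact hR _ (hω.trans ((hXdist i).le_apply ω))) (hN ω hω n)
    linarith
  have med_close : ∀ α : unitInterval, 0 < α → ∀ ε : ℝ, 0 < ε → ∀ᶠ n : ℕ in atTop, ∀ ω, α ≤ P ω →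
      dist (Fuzzy.med fun i : Fin (n + 1) => Z i ω) (Y ω + m) < ε := by
    intro α hα ε hε
    obtain ⟨N, hN⟩ := hdev α hα ε hε
    filter_upwards [eventually_ge_atTop (2 * N + 1)] with n hn ω hω
    rw [Real.dist_eq]
    exact Fuzzy.abs_med_sub_lt (hN ω hω n) hn
  exact ⟨Fuzzy.convergesInMeasure_of_uniform ave_close,
    Fuzzy.convergesAlmostSurely_of_uniform ave_close,
    Fuzzy.convergesInMeasure_of_uniform med_close,
    Fuzzy.convergesAlmostSurely_of_uniform med_close⟩
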